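/- Let $G_0\le G_1\le G_2\le\cdots$ be an increasing sequence of locally compact Hausdorff groups, each $G_n$ a topological subgroup of $G_{n+1}$, and let $K_0\le K_1\le\cdots$ be compact groups with $K_n\le G_n$ such that, for every $n$, $(G_n,K_n)$ is a Gelfand pair (that is, the convolution algebra $L^1(K_n\backslash G_n/K_n)$ of Haar-integrable bi-$K_n$-invariant functions on $G_n$ is commutative) and $G_n\cap K_{n+1}=K_n$. Let $G_\infty=\bigcup_n G_n$ and $K_\infty=\bigcup_n K_n$ with the direct limit topologies; one says that $(G_\infty,K_\infty)$ is a direct-limit Gelfand pair. Let $\mathrm{RUC}_b(K_\infty)$ be the space of bounded functions $f:K_\infty\to\mathbb{C}$ for which $k\mapsto L_kf$, where $L_kf(h)=f(k^{-1}h)$, is continuous from $K_\infty$ to $\ell^\infty(K_\infty)$. An invariant mean on $\mathrm{RUC}_b(K_\infty)$ is a continuous linear functional $\mu$ on it such that $\mu(\mathbf 1)=1$, $\mu(f)\ge 0$ whenever $f\ge 0$, and $\mu(L_kf)=\mu(f)$ for all $k\in K_\infty$. A function $\varphi:G_\infty\to\mathbb{C}$ is spherical with respect to $\mu$ if it is continuous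 and, for all $x,y\in G_\infty$, the function $k\mapsto\varphi(xky)$ belongs to $\mathrm{RUC}_b(K_\infty)$ and its value under $\mu$ is $\varphi(x)\varphi(y)$. An irreducible (strongly continuous) unitary representation $(\pi,\mathcal H)$ of $G_\infty$ on a complex Hilbert space is spherical if the space $\mathcal H^{K_\infty}$ of $K_\infty$-fixed vectors is nonzero. Let $\varphi:G_\infty\to\mathbb{C}$ be a positive-definite function with $\varphi(e)=1$. Then the following are equivalent: 1. $\varphi$ is spherical with respect to every invariant mean on $\mathrm{RUC}_b(K_\infty)$. 2. There exists an invariant mean on $\mathrm{RUC}_b(K_\infty)$ with respect to which $\varphi$ is spherical. 3. There exist an irreducible unitary spherical representation $(\pi,\mathcal H)$ of $G_\infty$ and a unit vector $v\in\mathcal H^{K_\infty}$ such that $\varphi(g)=\langle\pi(g)v,v\rangle$ for all $g\in G_\infty$. 4. $\varphi$ is spherical in the sense of Olshanski, that is, $\varphi$ is continuous and $$\lim_{n\to\infty}\int_{K_n}\varphi(xky)\,dk=\varphi(x)\varphi(y)\qquad\text{for all }x,y\in G_\infty,$$ where $dk$ is the normalized Haar measure of $K_n$. -/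

import Mathlib

open Filter Topology MeasureTheory
open scoped ENNReal ComplexOrder

universe u

noncomputable section

/-! ### Uniformly continuous bounded functions and invariant means -/

/-- The left translate `(L_g f)(h) = f (g⁻¹ h)` of a bounded function `f ∈ ℓ^∞(G)`. -/
def leftTranslate {G : Type*} [Group G] (g : G) (f : lp (fun _ : G => ℂ) ∞) :
    lp (fun _ : G => ℂ) ∞ :=
  ⟨fun h => f (g⁻¹ * h), by
    obtain ⟨C, hC⟩ := memℓp_infty_iff.1 (lp.memℓp f)
    exact memℓp_infty ⟨C, by rintro _ ⟨h, rfl⟩; exact hC ⟨g⁻¹ * h, rfl⟩⟩⟩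

/-- `RUC_b(G)`: the bounded functions `f` on `G` for which `g ↦ L_g f` is continuous from `G`
to `ℓ^∞(G)` with the supremum norm. -/
def RUCb (G : Type*) [Group G] [TopologicalSpace G] :
    Submodule ℂ (lp (fun _ : G => ℂ) ∞) where
  carrier := {f | Continuous fun g : G => leftTranslate g f}
  add_mem' {a b} ha hb := by
    have h : (fun g : G => leftTranslate g (a + b)) =
        fun g => leftTranslate g a + leftTranslate g b := by
      funext g; ext h; rfl
    simp only [Set.mem_ofPred_eq] at ha hb ⊢
    rw [h]
    exact ha.add hb
  zero_mem' := by
    have h : (fun g : G => leftTranslate g (0 : lp (fun _ : G => ℂ) ∞)) = fun _ => 0 := by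
      funext g; ext h; rfl
    simp only [Set.mem_ofPred_eq]
    rw [h]
    exact continuous_const
  smul_mem' c a ha := by
    have h : (fun g : G => leftTranslate g (c • a)) = fun g => c • leftTranslate g a := by
      funext g; ext h; rfl
    simp only [Set.mem_ofPred_eq] at ha ⊢
    rw [h]
    exact ha.const_smul c

/-- A mean on `RUC_b(G)`: a continuous linear functional `μ` with `μ(1) = 1` and `μ(f) ≥ 0`
for `f ≥ 0` (in the order of `ℂ`, where `0 ≤ z` means that `z` is real and nonnegative). -/
structure IsMean {G : Type*} [Group G] [TopologicalSpace G] (μ : RUCb G →L[ℂ] ℂ) : Prop where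
  map_one : ∀ f : RUCb G, (∀ g, f.1 g = 1) → μ f = 1
  nonneg : ∀ f : RUCb G, (∀ g, 0 ≤ f.1 g) → 0 ≤ μ f

/-- An invariant mean on `RUC_b(G)`: a mean with `μ(L_g f) = μ(f)` for all `g` and `f`. -/
structure IsInvariantMean {G : Type*} [Group G] [TopologicalSpace G] (μ : RUCb G →L[ℂ] ℂ) : Prop
    extends IsMean μ where
  invariant : ∀ (g : G) (f f' : RUCb G), f'.1 = leftTranslate g f.1 → μ f' = μ f

/-! ### Gelfand pairs -/

/-- The convolution `(f * f')(x) = ∫ f(y) f'(y⁻¹ x) dy` with respect to left Haar measure. -/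
def haarConvolution {G : Type*} [Group G] [TopologicalSpace G] [IsTopologicalGroup G]
    [LocallyCompactSpace G] (f f' : G → ℂ) (x : G) : ℂ :=
  letI : MeasurableSpace G := borel G
  haveI : BorelSpace G := ⟨rfl⟩
  ∫ y, f y * f' (y⁻¹ * x) ∂(Measure.haar : Measure G)

/-- Integrability with respect to left Haar measure on the Borel sets. -/
def HaarIntegrable {G : Type*} [Group G] [TopologicalSpace G] [IsTopologicalGroup G]
    [LocallyCompactSpace G] (f : G → ℂ) : Prop :=
  letI : MeasurableSpace G := borel G
  haveI : BorelSpace G := ⟨rfl⟩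
  Integrable f (Measure.haar : Measure G)

/-- Equality almost everywhere with respect to left Haar measure, that is, equality
in `L¹(G)`. -/
def HaarAEEq {G : Type*} [Group G] [TopologicalSpace G] [IsTopologicalGroup G]
    [LocallyCompactSpace G] (f f' : G → ℂ) : Prop :=
  letI : MeasurableSpace G := borel G
  haveI : BorelSpace G := ⟨rfl⟩
  f =ᵐ[(Measure.haar : Measure G)] f'

/-- `f` is bi-`K`-invariant. -/
def IsBiInvariant {G : Type*} [Group G] (K : Subgroup G) (f : G → ℂ) : Prop :=
  ∀ k ∈ K, ∀ k' ∈ K, ∀ x, f (k * x * k') = f x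

/-- `(G, K)` is a Gelfand pair: `G` is a locally compact (Hausdorff) group, `K` is a compact
subgroup, and the convolution algebra `L¹(K\G/K)` is commutative. -/
structure IsGelfandPair (G : Type*) [Group G] [TopologicalSpace G] (K : Subgroup G) : Prop
    extends IsTopologicalGroup G, LocallyCompactSpace G, T2Space G where
  isCompact : IsCompact (K : Set G)
  convolution_comm : ∀ f f' : G → ℂ, HaarIntegrable f → HaarIntegrable f' →
    IsBiInvariant K f → IsBiInvariant K f' →
    HaarAEEq (haarConvolution f f') (haarConvolution f' f)

/-! ### Direct limits of Gelfand pairs -/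

/-- Data exhibiting the topological space and group `G` as the direct limit `G_∞` of an increasing
sequence of Gelfand pairs `(G_n, K_n)` with `G_n ∩ K_{n+1} = K_n`: `G` is the union of the `G_n`
and carries the direct limit topology, in which a set is open as soon as its intersection with
each `G_n` is open in `G_n`. (Since the `G_n` are locally compact, `G` is then automatically a
Hausdorff topological group and each `G_n` is closed in `G`.) -/
structure DirectLimitGelfandPair (G : Type*) [Group G] [TopologicalSpace G] where
  /-- The locally compact groups `G_n`. -/
  grp : ℕ → Subgroup G
  /-- The compact groups `K_n`. -/
  cpt : ℕ → Subgroup G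
  grp_mono : Monotone grp
  cpt_mono : Monotone cpt
  cpt_le_grp : ∀ n, cpt n ≤ grp n
  isGelfandPair : ∀ n, IsGelfandPair (grp n) ((cpt n).subgroupOf (grp n))
  grp_inf_cpt_succ : ∀ n, grp n ⊓ cpt (n + 1) = cpt n
  exists_mem_grp : ∀ g : G, ∃ n, g ∈ grp n
  isCoherentWith : IsCoherentWith (Set.range fun n => (grp n : Set G))

namespace DirectLimitGelfandPair

variable {G : Type*} [Group G] [TopologicalSpace G] (D : DirectLimitGelfandPair G)

/-- The subgroup `K_∞ = ⋃ K_n` of `G_∞`. Its subspace topology is the direct limit topology,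
since `K_∞ ∩ G_n = K_n` is closed in `G_n` for each `n`. -/
def cptInfty : Subgroup G := ⨆ n, D.cpt n

theorem isTopologicalGroup_cpt (n : ℕ) : IsTopologicalGroup (D.cpt n) := by
  have : IsTopologicalGroup (D.grp n) := (D.isGelfandPair n).toIsTopologicalGroup
  refine IsInducing.topologicalGroup (Subgroup.inclusion (D.cpt_le_grp n)) ?_
  exact (IsInducing.of_comp_iff IsInducing.subtypeVal).1 IsInducing.subtypeVal

theorem compactSpace_cpt (n : ℕ) : CompactSpace (D.cpt n) := by
  suffices IsCompact (D.cpt n : Set G) from isCompact_iff_compactSpace.1 this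
  have h := (D.isGelfandPair n).isCompact.image continuous_subtype_val
  convert h using 1
  ext x
  simp only [SetLike.mem_coe, Set.mem_image, Subgroup.mem_subgroupOf, Subtype.exists,
    exists_and_right, exists_eq_right]
  exact ⟨fun hx => ⟨D.cpt_le_grp n hx, hx⟩, fun ⟨_, hx⟩ => hx⟩

end DirectLimitGelfandPair

/-- The integral of `f` over a compact group with respect to normalized Haar measure. -/
def haarAverage {K : Type*} [Group K] [TopologicalSpace K] [IsTopologicalGroup K] [CompactSpace K]
    (f : K → ℂ) : ℂ :=
  letI : MeasurableSpace K := borel K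
  haveI : BorelSpace K := ⟨rfl⟩
  ∫ k, f k ∂(Measure.haarMeasure (⊤ : TopologicalSpace.PositiveCompacts K))

/-- The integral `∫_{K_n} f(k) dk` with respect to the normalized Haar measure of `K_n`. -/
def DirectLimitGelfandPair.average {G : Type*} [Group G] [TopologicalSpace G]
    (D : DirectLimitGelfandPair G) (n : ℕ) (f : G → ℂ) : ℂ :=
  haveI := D.isTopologicalGroup_cpt n
  haveI := D.compactSpace_cpt n
  haarAverage fun k : D.cpt n => f k

/-! ### Positive-definite functions, spherical functions and spherical representations -/

/-- `φ` is positive-definite: `∑ᵢⱼ c̄ᵢ cⱼ φ(gᵢ⁻¹ gⱼ) ≥ 0` for all finite families. -/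
def IsPositiveDefiniteFun {G : Type*} [Group G] (φ : G → ℂ) : Prop :=
  ∀ (n : ℕ) (g : Fin n → G) (c : Fin n → ℂ),
    0 ≤ ∑ i, ∑ j, (starRingEnd ℂ) (c i) * c j * φ ((g i)⁻¹ * g j)

/-- `φ` is spherical with respect to the mean `μ` on `RUC_b(K)`: it is continuous and
`∫_K φ(xky) dμ(k) = φ(x) φ(y)` for all `x, y`, where `k ↦ φ(xky)` lies in `RUC_b(K)`. -/
def IsSphericalWrt {G : Type*} [Group G] [TopologicalSpace G] {K : Subgroup G}
    (μ : RUCb K →L[ℂ] ℂ) (φ : G → ℂ) : Prop :=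
  Continuous φ ∧ ∀ x y : G, ∃ F : RUCb K, (∀ k : K, F.1 k = φ (x * k * y)) ∧ μ F = φ x * φ y

/-- `φ` is spherical in the sense of Olshanski: it is continuous and
`lim_n ∫_{K_n} φ(xky) dk = φ(x) φ(y)` for all `x, y`. -/
def IsOlshanskiSpherical {G : Type*} [Group G] [TopologicalSpace G]
    (D : DirectLimitGelfandPair G) (φ : G → ℂ) : Prop :=
  Continuous φ ∧ ∀ x y : G,
    Tendsto (fun n => D.average n fun k => φ (x * k * y)) atTop (𝓝 (φ x * φ y))

/-- A unitary representation of `G` on a Hilbert space: a strongly continuous homomorphism to the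
unitary group. -/
structure UnitaryRep (G : Type*) [Group G] [TopologicalSpace G] (H : Type*)
    [NormedAddCommGroup H] [InnerProductSpace ℂ H] [CompleteSpace H] where
  toHom : G →* unitary (H →L[ℂ] H)
  continuous_apply : ∀ v : H, Continuous fun g => (toHom g : H →L[ℂ] H) v

namespace UnitaryRep

variable {G : Type*} [Group G] [TopologicalSpace G] {H : Type*}
  [NormedAddCommGroup H] [InnerProductSpace ℂ H] [CompleteSpace H]

/-- The operator `π(g)`. -/
def op (π : UnitaryRep G H) (g : G) : H →L[ℂ] H := (π.toHom g : H →L[ℂ] H)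

/-- `π` is irreducible: `H ≠ 0`, and `0` and `H` are the only closed invariant subspaces. -/
def IsIrreducible (π : UnitaryRep G H) : Prop :=
  Nontrivial H ∧ ∀ M : Submodule ℂ H, IsClosed (M : Set H) →
    (∀ g, ∀ v ∈ M, π.op g v ∈ M) → M = ⊥ ∨ M = ⊤

/-- The space `H^K` of vectors fixed by `K`. -/
def fixedVectors (π : UnitaryRep G H) (K : Subgroup G) : Submodule ℂ H where
  carrier := {v | ∀ k ∈ K, π.op k v = v}
  add_mem' ha hb k hk := by rw [map_add, ha k hk, hb k hk]
  zero_mem' k _ := map_zero _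
  smul_mem' c a ha k hk := by rw [map_smul, ha k hk]

/-- `π` is an irreducible unitary spherical representation: it is irreducible and `H^K ≠ 0`. -/
def IsSpherical (π : UnitaryRep G H) (K : Subgroup G) : Prop :=
  π.IsIrreducible ∧ π.fixedVectors K ≠ ⊥

end UnitaryRep

end

/-!
Write `P` for the orthogonal projection onto the `K_∞`-fixed vectors of a unitary representation
`π` of `G_∞`, and `P_n` for the projection onto the `K_n`-fixed vectors. All four conditions are
compared with the factorization

  `⟪π(x⁻¹) v, P π(y) v⟫ = φ(x) φ(y)`,  where `φ(g) = ⟪v, π(g) v⟫`.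

*Averages compute `P`.* A conjugate-linear functional `a ↦ F(a)` that is `K`-invariant and equals
`⟪a, b⟫` on fixed vectors is `⟪a, P b⟫` (`UnitaryRep.eq_inner_fixedProj`). Hence the value of every
invariant mean on the coefficient `k ↦ ⟪a, π(k) b⟫` is `⟪a, P b⟫`
(`IsInvariantMean.apply_coeff`), and the Haar average over `K_n` is `⟪a, P_n b⟫`, which
tends to `⟪a, P b⟫` (`DirectLimitGelfandPair.average_inner_op`, `UnitaryRep.tendsto_fixedProj`).
As `φ(x k y) = ⟪π(x⁻¹) v, π(k) π(y) v⟫`, being spherical, with respect to one invariant mean or to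
all of them or in the sense of Olshanski, is the factorization above.

*Factorization gives irreducibility.* In the Gelfand–Naimark–Segal representation of `φ`
(`IsPositiveDefiniteFun.exists_unitaryRep`) the vector `v` is cyclic, so the factorization says that
`P` is the rank-one projection onto `v`. Then every closed invariant subspace contains `v` or is
orthogonal to it (`UnitaryRep.isSpherical_of_isCyclicVector`).

*Irreducibility gives factorization.* This is where the Gelfand property enters. For `x, y ∈ G_n`
commutativity of the convolution makes `P_n π(x) P_n` and `P_n π(y) P_n` commute
(`IsGelfandPair.inner_op_fixedProj_op_comm`), and in the limit so do `P π(x) P` and `P π(y) P`.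
These form a commuting self-adjoint family without closed invariant subspaces in the space of
fixed vectors, which is therefore one-dimensional by a form of Schur's lemma
(`exists_eq_smul_of_commute_of_irreducible`, `UnitaryRep.IsIrreducible.fixedProj_eq`).

Finally, invariant means exist: an ultrafilter limit of the Haar averages over the `K_n` is one
(`DirectLimitGelfandPair.exists_isInvariantMean`).
-/

noncomputable section

/-! ### Unitary representations and their fixed vectors -/

namespace UnitaryRep

variable {G : Type*} [Group G] [TopologicalSpace G] {H : Type*}
  [NormedAddCommGroup H] [InnerProductSpace ℂ H] [CompleteSpace H] (π : UnitaryRep G H)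

theorem op_one (v : H) : π.op 1 v = v := by simp [op]

theorem op_mul (g h : G) (v : H) : π.op (g * h) v = π.op g (π.op h v) := by simp [op]

theorem op_inv_op (g : G) (v : H) : π.op g⁻¹ (π.op g v) = v := by
  rw [← op_mul, inv_mul_cancel, op_one]

theorem op_op_inv (g : G) (v : H) : π.op g (π.op g⁻¹ v) = v := by
  rw [← op_mul, mul_inv_cancel, op_one]

theorem inner_op_op (g : G) (v w : H) : inner ℂ (π.op g v) (π.op g w) = inner ℂ v w :=
  Unitary.inner_map_map (π.toHom g) v w

theorem inner_op_left (g : G) (v w : H) : inner ℂ (π.op g v) w = inner ℂ v (π.op g⁻¹ w) := by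
  rw [← π.inner_op_op g v, op_op_inv]

theorem inner_op_right (g : G) (v w : H) : inner ℂ v (π.op g w) = inner ℂ (π.op g⁻¹ v) w := by
  rw [inner_op_left, inv_inv]

theorem norm_op (g : G) (v : H) : ‖π.op g v‖ = ‖v‖ := Unitary.norm_map (π.toHom g) v

theorem continuous_op (v : H) : Continuous fun g => π.op g v := π.continuous_apply v

/-- The restriction of a unitary representation to a subgroup. -/
def restrict (L : Subgroup G) : UnitaryRep L H where
  toHom := π.toHom.comp L.subtype
  continuous_apply v := (π.continuous_apply v).comp continuous_subtype_val

theorem restrict_op (L : Subgroup G) (g : L) : (π.restrict L).op g = π.op g := rfl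

variable (K : Subgroup G)

theorem isClosed_fixedVectors : IsClosed (π.fixedVectors K : Set H) := by
  have : (π.fixedVectors K : Set H) = ⋂ k ∈ K, {v | π.op k v = v} := by
    ext v; simp [fixedVectors]
  rw [this]
  exact isClosed_biInter fun k _ => isClosed_eq (π.op k).continuous continuous_id

instance : CompleteSpace (π.fixedVectors K) := (π.isClosed_fixedVectors K).completeSpace_coe

/-- The orthogonal projection of the Hilbert space onto the subspace of `K`-fixed vectors. -/
def fixedProj : H →L[ℂ] H := (π.fixedVectors K).starProjection

theorem fixedProj_mem (v : H) : π.fixedProj K v ∈ π.fixedVectors K :=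
  Submodule.starProjection_apply_mem _ v

variable {K}

theorem fixedProj_eq_self {v : H} (hv : v ∈ π.fixedVectors K) : π.fixedProj K v = v :=
  Submodule.starProjection_eq_self_iff.2 hv

theorem inner_fixedProj_left (v w : H) :
    inner ℂ (π.fixedProj K v) w = inner ℂ v (π.fixedProj K w) :=
  Submodule.inner_starProjection_left_eq_right _ v w

theorem inner_fixedProj_of_mem {a : H} (ha : a ∈ π.fixedVectors K) (b : H) :
    inner ℂ a (π.fixedProj K b) = inner ℂ a b := by
  rw [← inner_fixedProj_left, π.fixedProj_eq_self ha]

theorem op_fixedProj {k : G} (hk : k ∈ K) (v : H) :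
    π.op k (π.fixedProj K v) = π.fixedProj K v :=
  π.fixedProj_mem K v k hk

theorem fixedProj_op {k : G} (hk : k ∈ K) (v : H) :
    π.fixedProj K (π.op k v) = π.fixedProj K v := by
  refine ext_inner_left ℂ fun w => ?_
  rw [← inner_fixedProj_left, ← inner_fixedProj_left, inner_op_right,
    π.op_fixedProj (inv_mem hk)]

/-- A bounded conjugate-linear functional `F` that is `K`-invariant and agrees with `⟪·, b⟫` on
the `K`-fixed vectors is `⟪·, P b⟫`, where `P` is the projection onto the `K`-fixed vectors.
By Riesz, `F = ⟪·, w⟫`, and the two conditions say that `w` is fixed and that `w - b` is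
orthogonal to the fixed vectors. -/
theorem eq_inner_fixedProj (b : H) (F : H → ℂ) (C : ℝ) (hadd : ∀ x y, F (x + y) = F x + F y)
    (hsmul : ∀ (c : ℂ) x, F (c • x) = (starRingEnd ℂ) c * F x) (hC : ∀ x, ‖F x‖ ≤ C * ‖x‖)
    (hinv : ∀ k ∈ K, ∀ x, F (π.op k x) = F x)
    (hfix : ∀ x ∈ π.fixedVectors K, F x = inner ℂ x b) (a : H) :
    F a = inner ℂ a (π.fixedProj K b) := by
  let L : H →ₗ[ℂ] ℂ :=
    { toFun x := (starRingEnd ℂ) (F x)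
      map_add' x y := by simp [hadd]
      map_smul' c x := by simp [hsmul] }
  let L' : H →L[ℂ] ℂ := L.mkContinuous C fun x => by simpa [L] using hC x
  obtain ⟨w, hw⟩ := (InnerProductSpace.toDual ℂ H).surjective L'
  have hF : ∀ x, F x = inner ℂ x w := by
    intro x
    have h : inner ℂ w x = (starRingEnd ℂ) (F x) := by
      rw [← InnerProductSpace.toDual_apply_apply (𝕜 := ℂ), hw]; rfl
    rw [← inner_conj_symm, h, Complex.conj_conj]
  have hwK : w ∈ π.fixedVectors K := by
    intro k hk
    refine ext_inner_left ℂ fun x => ?_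
    rw [inner_op_right, ← hF, ← hF, hinv _ (inv_mem hk)]
  have : π.fixedProj K b = w := by
    refine ext_inner_left ℂ fun x => ?_
    rw [← inner_fixedProj_left, ← hfix _ (π.fixedProj_mem K x), hF, inner_fixedProj_left,
      π.fixedProj_eq_self hwK]
  rw [this, hF]

theorem fixedVectors_iSup {ι : Type*} (L : ι → Subgroup G) :
    π.fixedVectors (⨆ i, L i) = ⨅ i, π.fixedVectors (L i) := by
  ext v
  simp only [Submodule.mem_iInf]
  refine ⟨fun hv i k hk => hv k (Subgroup.mem_iSup_of_mem i hk), fun hv k hk => ?_⟩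
  let S : Subgroup G :=
    { carrier := {k | π.op k v = v}
      mul_mem' := fun {a b} ha hb => by
        simp only [Set.mem_ofPred_eq] at ha hb ⊢; rw [op_mul, hb, ha]
      one_mem' := π.op_one v
      inv_mem' := fun {a} ha => by
        simp only [Set.mem_ofPred_eq] at ha ⊢; nth_rw 1 [← ha]; rw [op_inv_op] }
  have : ⨆ i, L i ≤ S := iSup_le fun i k hk => hv i k hk
  exact this hk

/-- For an increasing sequence of subgroups, the projections onto the fixed vectors converge
strongly to the projection onto the vectors fixed by the union. -/
theorem tendsto_fixedProj {L : ℕ → Subgroup G} (hL : Monotone L) (v : H) :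
    Tendsto (fun n => π.fixedProj (L n) v) atTop (𝓝 (π.fixedProj (⨆ n, L n) v)) := by
  -- pass to the increasing sequence of orthogonal complements
  have hmono : Monotone fun n => (π.fixedVectors (L n))ᗮ := fun m n hmn =>
    Submodule.orthogonal_le fun w hw k hk => hw k (hL hmn hk)
  have hlim := Submodule.starProjection_tendsto_closure_iSup _ hmono v
  have hsup : (⨆ n, (π.fixedVectors (L n))ᗮ).topologicalClosure =
      (π.fixedVectors (⨆ n, L n))ᗮ := by
    rw [← Submodule.orthogonal_orthogonal_eq_closure, ← Submodule.iInf_orthogonal,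
      fixedVectors_iSup]
    congr 1
    refine iInf_congr fun n => ?_
    exact Submodule.orthogonal_orthogonal _
  have hcompl : ∀ M : Submodule ℂ H, ∀ [M.HasOrthogonalProjection],
      M.starProjection v = v - Mᗮ.starProjection v := fun M _ => by
    rw [Submodule.starProjection_orthogonal_val]; simp
  have e : ∀ (M N : Submodule ℂ H) [M.HasOrthogonalProjection] [N.HasOrthogonalProjection],
      M = N → M.starProjection v = N.starProjection v := by
    rintro M _ _ _ rfl; rfl
  rw [e _ _ hsup] at hlim
  simp only [fixedProj]
  rw [hcompl]
  simp_rw [fun n => hcompl (π.fixedVectors (L n))]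
  exact hlim.const_sub v

end UnitaryRep

/-! ### The Gelfand–Naimark–Segal construction for groups -/

/-- `v` is a cyclic vector: its orbit spans a dense subspace. -/
def UnitaryRep.IsCyclicVector {G : Type*} [Group G] [TopologicalSpace G] {H : Type*}
    [NormedAddCommGroup H] [InnerProductSpace ℂ H] [CompleteSpace H] (π : UnitaryRep G H)
    (v : H) : Prop :=
  (Submodule.span ℂ (Set.range fun g => π.op g v)).topologicalClosure = ⊤

theorem IsPositiveDefiniteFun.sum_nonneg {G : Type*} [Group G] {φ : G → ℂ}
    (hφ : IsPositiveDefiniteFun φ) {ι : Type*} (s : Finset ι) (g : ι → G) (c : ι → ℂ) :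
    0 ≤ ∑ i ∈ s, ∑ j ∈ s, (starRingEnd ℂ) (c i) * c j * φ ((g i)⁻¹ * g j) := by
  have h := hφ s.card (fun i => g (s.equivFin.symm i)) fun i => c (s.equivFin.symm i)
  rw [← Finset.sum_coe_sort s]
  simp_rw [← Finset.sum_coe_sort s]
  rw [← s.equivFin.symm.sum_comp]
  simp_rw [← s.equivFin.symm.sum_comp fun j : s => _ * c j * φ (_ * g j)]
  exact h

theorem IsPositiveDefiniteFun.map_inv {G : Type*} [Group G] {φ : G → ℂ}
    (hφ : IsPositiveDefiniteFun φ) (g : G) : φ g⁻¹ = (starRingEnd ℂ) (φ g) := by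
  have h1 := Complex.le_def.1 (hφ 1 ![1] ![1])
  have h2 := Complex.le_def.1 (hφ 2 ![1, g] ![1, 1])
  have h3 := Complex.le_def.1 (hφ 2 ![1, g] ![1, Complex.I])
  simp [Fin.sum_univ_two] at h1 h2 h3
  apply Complex.ext <;> simp <;> linarith [h1.2, h2.2, h3.2]

/-- The Gram kernel `(x, y) ↦ φ (x⁻¹ y)`, as an operator-valued kernel on `ℂ`. -/
def gramKernel {G : Type*} [Group G] (φ : G → ℂ) : Matrix G G (ℂ →L[ℂ] ℂ) :=
  .of fun x y => φ (x⁻¹ * y) • ContinuousLinearMap.id ℂ ℂ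

theorem IsPositiveDefiniteFun.posSemidef_gramKernel {G : Type*} [Group G] {φ : G → ℂ}
    (hφ : IsPositiveDefiniteFun φ) : (gramKernel φ).PosSemidef := by
  refine ((RKHS.posSemidef_tfae (K := gramKernel φ)).out 0 1).2 ?_
  refine ⟨?_, fun f => ?_⟩
  · ext x y
    have := hφ.map_inv (y⁻¹ * x)
    simp only [mul_inv_rev, inv_inv] at this
    simp [gramKernel, Matrix.conjTranspose_apply, this, ContinuousLinearMap.star_eq_adjoint,
      ContinuousLinearMap.adjoint_id]
  · -- the second components of the indices are absorbed into the coefficients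
    have h := (Complex.le_def.1 (hφ.sum_nonneg f.support (fun p => p.1)
      fun p => f p * p.2)).1
    rw [Complex.zero_re] at h
    convert h using 1
    simp only [Finsupp.sum, RCLike.re_eq_complex_re]
    congr 1
    refine Finset.sum_congr rfl fun p _ => Finset.sum_congr rfl fun q _ => ?_
    have := hφ.map_inv (q.1⁻¹ * p.1)
    simp only [mul_inv_rev, inv_inv] at this
    simp [gramKernel, this]
    ring

/-- A positive-definite function is the Gram function of a total family of vectors of a Hilbert
space. -/
theorem IsPositiveDefiniteFun.exists_gram {G : Type u} [Group G] {φ : G → ℂ}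
    (hφ : IsPositiveDefiniteFun φ) :
    ∃ (H : Type u) (_ : NormedAddCommGroup H) (_ : InnerProductSpace ℂ H) (_ : CompleteSpace H)
      (δ : G → H), (∀ x y, inner ℂ (δ x) (δ y) = φ (x⁻¹ * y)) ∧
        (Submodule.span ℂ (Set.range δ)).topologicalClosure = ⊤ := by
  have : Fact (gramKernel φ).PosSemidef := ⟨hφ.posSemidef_gramKernel⟩
  let H := RKHS.OfKernel (gramKernel φ)
  refine ⟨H, inferInstance, inferInstance, inferInstance, fun x => RKHS.kerFun H x 1, ?_, ?_⟩
  · intro x y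
    rw [← RKHS.kernel_inner, RKHS.OfKernel.kernel_ofKernel]
    have := hφ.map_inv (y⁻¹ * x)
    simp only [mul_inv_rev, inv_inv] at this
    simp [gramKernel, this]
  · refine top_unique ?_
    rw [← RKHS.kerFun_dense H]
    refine Submodule.topologicalClosure_mono (Submodule.span_le.2 ?_)
    rintro _ ⟨x, c, rfl⟩
    have : RKHS.kerFun H x c = c • RKHS.kerFun H x 1 := by
      rw [← map_smul, smul_eq_mul, mul_one]
    rw [this]
    exact Submodule.smul_mem _ _ (Submodule.subset_span ⟨x, rfl⟩)

/-- The Gelfand–Naimark–Segal construction. The group need not be a topological group: separate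
continuity of `φ (a g b)` in `g` gives strong continuity. -/
theorem IsPositiveDefiniteFun.exists_unitaryRep {G : Type u} [Group G] [TopologicalSpace G]
    {φ : G → ℂ} (hφ : IsPositiveDefiniteFun φ)
    (hcont : ∀ a b, Continuous fun g => φ (a * g * b)) :
    ∃ (H : Type u) (_ : NormedAddCommGroup H) (_ : InnerProductSpace ℂ H) (_ : CompleteSpace H)
      (π : UnitaryRep G H) (v : H), (∀ g, φ g = inner ℂ v (π.op g v)) ∧ π.IsCyclicVector v := by
  obtain ⟨H, _, _, _, δ, hδ, hspan⟩ := hφ.exists_gram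
  have hdense : Dense (Submodule.span ℂ (Set.range δ) : Set H) := by
    rw [dense_iff_closure_eq, ← Submodule.topologicalClosure_coe, hspan]; rfl
  let e : (G →₀ ℂ) →ₗ[ℂ] H := Finsupp.linearCombination ℂ δ
  have he : DenseRange e := by
    rw [DenseRange, ← LinearMap.coe_range, Finsupp.range_linearCombination]; exact hdense
  let f (g : G) : (G →₀ ℂ) ≃ₗ[ℂ] (G →₀ ℂ) := Finsupp.domLCongr (Equiv.mulLeft g)
  have hinner : ∀ (g : G) (x y : G →₀ ℂ), inner ℂ (e (f g x)) (e (f g y)) = inner ℂ (e x) (e y) := by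
    intro g x y
    induction x using Finsupp.induction_linear with
    | zero => simp
    | add x x' hx hx' => simp only [map_add, inner_add_left, hx, hx']
    | single a c =>
      induction y using Finsupp.induction_linear with
      | zero => simp
      | add y y' hy hy' => simp only [map_add, inner_add_right, hy, hy']
      | single b d => simp [e, f, hδ, mul_assoc]
  have hnorm : ∀ (g : G) (x : G →₀ ℂ), ‖e (f g x)‖ = ‖e x‖ := fun g x => by
    rw [@norm_eq_sqrt_re_inner ℂ, hinner, ← @norm_eq_sqrt_re_inner ℂ]
  let U (g : G) : H ≃ₗᵢ[ℂ] H := LinearEquiv.extendOfIsometry (f g) e e he he (hnorm g)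
  have hUe : ∀ g x, U g (e x) = e (f g x) := fun g x =>
    LinearEquiv.extendOfIsometry_eq (f g) e e he he (hnorm g) x
  have hUδ : ∀ g x, U g (δ x) = δ (g * x) := fun g x => by
    have := hUe g (Finsupp.single x 1)
    simpa [e, f] using this
  have hext : ∀ T S : H →L[ℂ] H, (∀ x, T (δ x) = S (δ x)) → T = S := fun T S h => by
    refine ContinuousLinearMap.ext_on hdense ?_
    rintro _ ⟨x, rfl⟩; exact h x
  let toHom : G →* unitary (H →L[ℂ] H) :=
    { toFun g := Unitary.linearIsometryEquiv.symm (U g)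
      map_one' := by
        refine Subtype.ext (hext _ _ fun x => ?_)
        simp [hUδ]
      map_mul' g h := by
        refine Subtype.ext (hext _ _ fun x => ?_)
        simp [hUδ, mul_assoc] }
  have htoHom : ∀ g v, (toHom g : H →L[ℂ] H) v = U g v := fun g v => by simp [toHom]
  have hcontU : ∀ v, Continuous fun g => U g v := by
    have hweak : ∀ p q : G →₀ ℂ, Continuous fun g => inner ℂ (e p) (U g (e q)) := by
      intro p q
      induction p using Finsupp.induction_linear with
      | zero => simpa using continuous_const
      | add p p' hp hp' => simp only [map_add, inner_add_left]; exact hp.add hp'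
      | single a c =>
        induction q using Finsupp.induction_linear with
        | zero => simpa using continuous_const
        | add q q' hq hq' => simp only [map_add, inner_add_right]; exact hq.add hq'
        | single b d =>
          have : (fun g => inner ℂ (e (Finsupp.single a c)) (U g (e (Finsupp.single b d)))) =
              fun g => (starRingEnd ℂ) c * (d * φ (a⁻¹ * g * b)) := by
            funext g
            simp [e, hUδ, hδ, mul_assoc]
            ring
          rw [this]
          exact ((hcont a⁻¹ b).const_mul d).const_mul _
    have hstrong : ∀ q : G →₀ ℂ, Continuous fun g => U g (e q) := by
      intro q
      refine continuous_iff_continuousAt.2 fun g₀ => ?_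
      rw [ContinuousAt, tendsto_iff_norm_sub_tendsto_zero]
      -- `‖U g y - U g₀ y‖² = 2‖y‖² - 2 Re ⟪U g₀ y, U g y⟫`, and `U g₀ y` is again in the span
      have hsq : ∀ g, ‖U g (e q) - U g₀ (e q)‖ =
          √(2 * ‖e q‖ ^ 2 - 2 * (inner ℂ (e (f g₀ q)) (U g (e q))).re) := by
        intro g
        rw [eq_comm, Real.sqrt_eq_iff_eq_sq _ (norm_nonneg _)]
        · rw [norm_sub_rev, @norm_sub_sq ℂ, ← hUe]
          simp only [LinearIsometryEquiv.norm_map, RCLike.re_eq_complex_re]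
          ring
        · have h1 := @re_inner_le_norm ℂ _ _ _ _ (e (f g₀ q)) (U g (e q))
          rw [hnorm, LinearIsometryEquiv.norm_map, RCLike.re_eq_complex_re] at h1
          nlinarith
      have hlim : Tendsto (fun g => √(2 * ‖e q‖ ^ 2 -
          2 * (inner ℂ (e (f g₀ q)) (U g (e q))).re)) (𝓝 g₀)
          (𝓝 (√(2 * ‖e q‖ ^ 2 - 2 * (inner ℂ (e (f g₀ q)) (U g₀ (e q))).re))) := by
        refine Continuous.tendsto ?_ g₀
        exact Real.continuous_sqrt.comp
          (continuous_const.sub ((Complex.continuous_re.comp (hweak _ q)).const_mul 2))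
      simp_rw [← hsq] at hlim
      simpa using hlim
    intro v
    refine continuous_of_uniform_approx_of_continuous fun u hu => ?_
    obtain ⟨ε, hε, hεu⟩ := Metric.mem_uniformity_dist.1 hu
    obtain ⟨_, ⟨q, rfl⟩, hq⟩ := Metric.mem_closure_iff.1 (he v) ε hε
    exact ⟨_, hstrong q, fun g => hεu (by rwa [LinearIsometryEquiv.dist_map])⟩
  refine ⟨H, _, _, _, ⟨toHom, fun v => by simpa only [htoHom] using hcontU v⟩, δ 1, ?_, ?_⟩
  · intro g
    simp [UnitaryRep.op, htoHom, hUδ, hδ]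
  · simpa [UnitaryRep.IsCyclicVector, UnitaryRep.op, htoHom, hUδ] using hspan

/-! ### Irreducibility and one-dimensional spaces of fixed vectors -/

namespace UnitaryRep

variable {G : Type*} [Group G] [TopologicalSpace G] {H : Type*}
  [NormedAddCommGroup H] [InnerProductSpace ℂ H] [CompleteSpace H] {π : UnitaryRep G H}
  {K : Subgroup G}

theorem IsCyclicVector.dense {v : H} (hv : π.IsCyclicVector v) :
    Dense (Submodule.span ℂ (Set.range fun g => π.op g v) : Set H) := by
  rw [dense_iff_closure_eq, ← Submodule.topologicalClosure_coe, show _ = _ from hv]; rfl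

theorem IsCyclicVector.eq_top {v : H} (hv : π.IsCyclicVector v) {M : Submodule ℂ H}
    (hM : IsClosed (M : Set H)) (h : ∀ g, π.op g v ∈ M) : M = ⊤ := by
  refine top_unique ?_
  rw [← show _ = _ from hv]
  refine Submodule.topologicalClosure_minimal _ (Submodule.span_le.2 ?_) hM
  rintro _ ⟨g, rfl⟩
  exact h g

theorem fixedProj_eq_of_isCyclicVector {v : H} (hv : π.IsCyclicVector v)
    (h : ∀ x y, inner ℂ (π.op x v) (π.fixedProj K (π.op y v)) =
      inner ℂ (π.op x v) v * inner ℂ v (π.op y v)) (w : H) :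
    π.fixedProj K w = (inner ℂ v w : ℂ) • v := by
  have key : π.fixedProj K = (innerSL ℂ v).smulRight v := by
    refine ContinuousLinearMap.ext_on hv.dense ?_
    rintro _ ⟨y, rfl⟩
    refine hv.dense.eq_of_inner_right ℂ fun z hz => ?_
    induction hz using Submodule.span_induction with
    | mem z hz =>
      obtain ⟨x, rfl⟩ := hz
      simpa [inner_smul_right, mul_comm] using h x y
    | zero => simp
    | add a b _ _ ha hb => rw [inner_add_left, inner_add_left, ha, hb]
    | smul c a _ ha => rw [inner_smul_left, inner_smul_left, ha]
  rw [key]; simp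

theorem starProjection_op {M : Submodule ℂ H} [M.HasOrthogonalProjection]
    (hM : ∀ g, ∀ w ∈ M, π.op g w ∈ M) (g : G) (w : H) :
    M.starProjection (π.op g w) = π.op g (M.starProjection w) := by
  refine Submodule.eq_starProjection_of_mem_of_inner_eq_zero
    (hM g _ (Submodule.starProjection_apply_mem _ _)) fun z hz => ?_
  rw [← map_sub, inner_op_left]
  exact Submodule.starProjection_inner_eq_zero _ _ (hM g⁻¹ z hz)

/-- If the projection onto the `K`-fixed vectors is the rank-one projection onto a cyclic unit
vector, then the representation is irreducible: the projection of the cyclic vector to a closed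
invariant subspace is again `K`-fixed, hence a multiple of the cyclic vector. -/
theorem isSpherical_of_isCyclicVector {v : H} (hv : π.IsCyclicVector v) (hv1 : ‖v‖ = 1)
    (h : ∀ w, π.fixedProj K w = (inner ℂ v w : ℂ) • v) :
    π.IsSpherical K ∧ v ∈ π.fixedVectors K := by
  have hv0 : v ≠ 0 := by rintro rfl; simp at hv1
  have hvK : v ∈ π.fixedVectors K := by
    have := π.fixedProj_mem K v
    rwa [h, inner_self_eq_norm_sq_to_K, hv1, RCLike.ofReal_one, one_pow, one_smul] at this
  refine ⟨⟨⟨⟨v, 0, hv0⟩, fun M hMc hM => ?_⟩, fun hbot => ?_⟩, hvK⟩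
  · have : CompleteSpace M := hMc.completeSpace_coe
    have hfix : M.starProjection v ∈ π.fixedVectors K := fun k hk => by
      rw [← starProjection_op hM, hvK k hk]
    have hc := h (M.starProjection v)
    rw [π.fixedProj_eq_self hfix] at hc
    by_cases h0 : inner ℂ v (M.starProjection v) = 0
    · left
      rw [h0, zero_smul] at hc
      have : Mᗮ = ⊤ := hv.eq_top (Submodule.isClosed_orthogonal M) fun g => by
        rw [← Submodule.starProjection_apply_eq_zero_iff, starProjection_op hM, hc, map_zero]
      rwa [Submodule.orthogonal_eq_top_iff] at this
    · right
      refine hv.eq_top hMc fun g => hM g v ?_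
      rw [← inv_smul_smul₀ h0 v, ← hc]
      exact M.smul_mem _ (Submodule.starProjection_apply_mem _ _)
  · rw [hbot] at hvK
    exact hv0 hvK

end UnitaryRep

/-- Schur's lemma for a commuting self-adjoint family of operators that has no closed invariant
subspace: if the spectrum of a member (a normal operator) had two points, continuous functions with
disjoint supports separating them would give a proper nonzero kernel invariant under the family. -/
theorem exists_eq_smul_of_commute_of_irreducible {E : Type*} [NormedAddCommGroup E]
    [InnerProductSpace ℂ E] [CompleteSpace E] {S : Set (E →L[ℂ] E)}
    (hcomm : ∀ a ∈ S, ∀ b ∈ S, Commute a b) (hstar : ∀ a ∈ S, star a ∈ S)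
    (hirr : ∀ M : Submodule ℂ E, IsClosed (M : Set E) → (∀ a ∈ S, ∀ v ∈ M, a v ∈ M) →
      M = ⊥ ∨ M = ⊤) {a : E →L[ℂ] E} (ha : a ∈ S) : ∃ c : ℂ, ∀ v, a v = c • v := by
  have hnorm : IsStarNormal a := ⟨hcomm _ (hstar a ha) _ ha⟩
  by_cases hsub : (spectrum ℂ a).Subsingleton
  · obtain h | ⟨c, hc⟩ := hsub.eq_empty_or_singleton
    · have : Subsingleton (E →L[ℂ] E) := by
        by_contra hne
        rw [not_subsingleton_iff_nontrivial] at hne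
        exact (spectrum.nonempty a).ne_empty h
      exact ⟨0, fun v => by rw [Subsingleton.elim a 0]; simp⟩
    · refine ⟨c, fun v => ?_⟩
      rw [CFC.eq_algebraMap_of_spectrum_subset_singleton a c hc.le]
      simp [Algebra.algebraMap_eq_smul_one]
  · exfalso
    rw [Set.not_subsingleton_iff] at hsub
    obtain ⟨z, hz, w, hw, hzw⟩ := hsub
    have hr : 0 < dist z w / 2 := half_pos (dist_pos.2 hzw)
    -- tents of radius `dist z w / 2` around the two spectral points
    let t (p : ℂ) : ℂ → ℂ := fun u => ((max 0 (dist z w / 2 - dist u p) : ℝ) : ℂ)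
    have ht : ∀ p, Continuous (t p) := fun p => by fun_prop
    have htne : ∀ p ∈ spectrum ℂ a, cfc (t p) a ≠ 0 := fun p hp h0 => by
      have hmem : t p p ∈ spectrum ℂ (cfc (t p) a) := by
        rw [cfc_map_spectrum (t p) a (hf := (ht p).continuousOn)]
        exact ⟨p, hp, rfl⟩
      have : Nontrivial (E →L[ℂ] E) := by
        by_contra hne
        rw [not_nontrivial_iff_subsingleton] at hne
        simp [spectrum.of_subsingleton] at hp
      rw [h0, spectrum.zero_eq, Set.mem_singleton_iff] at hmem
      simp only [t, dist_self, sub_zero, Complex.ofReal_eq_zero] at hmem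
      rw [max_eq_right hr.le] at hmem
      exact hr.ne' hmem
    have hmul : cfc (t z) a * cfc (t w) a = 0 := by
      rw [← cfc_mul _ _ a (ht z).continuousOn (ht w).continuousOn]
      convert cfc_const_zero ℂ a using 2
      funext u
      simp only [t, ← Complex.ofReal_mul]
      rw [Complex.ofReal_eq_zero, mul_eq_zero]
      by_contra! hne
      have h1 : dist u z < dist z w / 2 := by
        by_contra! h; exact hne.1 (max_eq_left (by linarith))
      have h2 : dist u w < dist z w / 2 := by
        by_contra! h; exact hne.2 (max_eq_left (by linarith))
      linarith [dist_triangle_left z w u]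
    obtain h | h := hirr (cfc (t z) a).toLinearMap.ker (cfc (t z) a).isClosed_ker
      fun b hb v hv => by
        have : Commute (cfc (t z) a) b := (hcomm a ha b hb).cfc (hcomm _ (hstar a ha) b hb) _
        have h' := congrArg (fun T : E →L[ℂ] E => T v) this.eq
        simp only [mul_apply_eq_comp] at h'
        simp only [LinearMap.mem_ker, ContinuousLinearMap.coe_coe] at hv ⊢
        rw [h', hv, map_zero]
    · refine htne w hw (ContinuousLinearMap.ext fun v => ?_)
      have : cfc (t w) a v ∈ (cfc (t z) a).toLinearMap.ker := by
        have := congrArg (fun T : E →L[ℂ] E => T v) hmul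
        simpa using this
      rw [h] at this
      simpa using this
    · refine htne z hz (ContinuousLinearMap.ext fun v => ?_)
      have : v ∈ (cfc (t z) a).toLinearMap.ker := by rw [h]; trivial
      simpa using this

namespace UnitaryRep

variable {G : Type*} [Group G] [TopologicalSpace G] {H : Type*}
  [NormedAddCommGroup H] [InnerProductSpace ℂ H] [CompleteSpace H] {π : UnitaryRep G H}
  {K : Subgroup G}

/-- The compression `P π(x) P` of `π(x)` to the space of `K`-fixed vectors. -/
def compression (π : UnitaryRep G H) (K : Subgroup G) (x : G) :
    π.fixedVectors K →L[ℂ] π.fixedVectors K :=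
  (π.fixedVectors K).orthogonalProjectionOnto ∘L π.op x ∘L (π.fixedVectors K).subtypeL

theorem coe_compression (x : G) (a : π.fixedVectors K) :
    (π.compression K x a : H) = π.fixedProj K (π.op x a) := rfl

theorem star_compression (x : G) : star (π.compression K x) = π.compression K x⁻¹ := by
  rw [ContinuousLinearMap.star_eq_adjoint, eq_comm, ContinuousLinearMap.eq_adjoint_iff]
  intro a b
  rw [Submodule.coe_inner, Submodule.coe_inner, coe_compression, coe_compression,
    π.inner_fixedProj_of_mem a.2, inner_fixedProj_left, π.fixedProj_eq_self b.2, inner_op_right]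

/-- If the compressions `P π(x) P` of an irreducible representation to the `K`-fixed vectors
commute, then the space of `K`-fixed vectors is at most one-dimensional. -/
theorem IsIrreducible.fixedProj_eq (hirr : π.IsIrreducible)
    (hcomm : ∀ a ∈ π.fixedVectors K, ∀ b ∈ π.fixedVectors K, ∀ x y,
      inner ℂ a (π.op x (π.fixedProj K (π.op y b))) =
        inner ℂ a (π.op y (π.fixedProj K (π.op x b))))
    {v : H} (hv : v ∈ π.fixedVectors K) (hv1 : ‖v‖ = 1) (w : H) :
    π.fixedProj K w = (inner ℂ v w : ℂ) • v := by
  have hcommute : ∀ x y, Commute (π.compression K x) (π.compression K y) := fun x y => by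
    refine ContinuousLinearMap.ext fun b => ext_inner_left ℂ fun a => ?_
    simpa only [Submodule.coe_inner, mul_apply_eq_comp, coe_compression,
      π.inner_fixedProj_of_mem a.2] using hcomm a a.2 b b.2 x y
  have hinv : ∀ W : Submodule ℂ (π.fixedVectors K), IsClosed (W : Set (π.fixedVectors K)) →
      (∀ T ∈ Set.range (π.compression K), ∀ v ∈ W, T v ∈ W) → W = ⊥ ∨ W = ⊤ := by
    intro W hW hWinv
    by_cases hbot : W = ⊥
    · exact Or.inl hbot
    right
    -- the closed span of the translates of `W` is everything, and it projects into `W`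
    let N : Submodule ℂ H :=
      W.comap ((π.fixedVectors K).orthogonalProjectionOnto : H →ₗ[ℂ] π.fixedVectors K)
    have hN : IsClosed (N : Set H) :=
      hW.preimage (π.fixedVectors K).orthogonalProjectionOnto.continuous
    let M : Submodule ℂ H := ⨅ g, N.comap (π.op g : H →ₗ[ℂ] H)
    have hWM : ∀ w ∈ W, (w : H) ∈ M := fun w hw => by
      simp only [M, Submodule.mem_iInf]
      exact fun g => hWinv _ ⟨g, rfl⟩ w hw
    have hM := hirr.2 M (by
      simp only [M, Submodule.coe_iInf]
      exact isClosed_iInter fun g => hN.preimage (π.op g).continuous) fun g v hv => by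
        simp only [M, Submodule.mem_iInf] at hv ⊢
        intro h
        have := hv (h * g)
        simpa only [Submodule.mem_comap, ContinuousLinearMap.coe_coe, op_mul] using this
    obtain hM | hM := hM
    · refine absurd ((Submodule.eq_bot_iff W).2 fun w hw => ?_) hbot
      have := hWM w hw
      rw [hM] at this
      simpa using this
    · refine top_unique fun a _ => ?_
      have ha : (a : H) ∈ M := by rw [hM]; trivial
      simp only [M, Submodule.mem_iInf] at ha
      have := ha 1
      simp only [Submodule.mem_comap, ContinuousLinearMap.coe_coe, op_one, N] at this
      simpa using this
  have hscalar := fun x => exists_eq_smul_of_commute_of_irreducible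
    (S := Set.range (π.compression K)) (by rintro _ ⟨x, rfl⟩ _ ⟨y, rfl⟩; exact hcommute x y)
    (by rintro _ ⟨x, rfl⟩; exact ⟨x⁻¹, (star_compression x).symm⟩) hinv ⟨x, rfl⟩
  have hv0 : v ≠ 0 := by rintro rfl; simp at hv1
  have htop : ℂ ∙ (⟨v, hv⟩ : π.fixedVectors K) = ⊤ := by
    refine (hinv _ (Submodule.closed_of_finiteDimensional _) ?_).resolve_left ?_
    · rintro _ ⟨x, rfl⟩ u hu
      obtain ⟨c, hc⟩ := hscalar x
      rw [hc]
      exact Submodule.smul_mem _ _ hu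
    · rw [Submodule.span_singleton_eq_bot]
      exact fun h => hv0 (congrArg Subtype.val h)
  have hmem : (⟨_, π.fixedProj_mem K w⟩ : π.fixedVectors K) ∈
      ℂ ∙ (⟨v, hv⟩ : π.fixedVectors K) := by rw [htop]; trivial
  obtain ⟨c, hc⟩ := Submodule.mem_span_singleton.1 hmem
  have hc' : c • v = π.fixedProj K w := congrArg Subtype.val hc
  rw [← π.inner_fixedProj_of_mem hv w, ← hc', inner_smul_right, inner_self_eq_norm_sq_to_K, hv1]
  simp

end UnitaryRep

/-! ### Gelfand pairs: commuting compressions -/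

section BiInvariant

variable {G : Type*} [Group G] [TopologicalSpace G] [IsTopologicalGroup G]

/-- At every point of a locally compact group there is a nonnegative bi-`K`-invariant compactly
supported continuous function that does not vanish there: the supremum of an arbitrary bump
function over its translates by the compact group `K × K`. -/
theorem exists_isBiInvariant_bump [LocallyCompactSpace G] {K : Subgroup G}
    (hK : IsCompact (K : Set G)) (x₀ : G) :
    ∃ χ : G → ℝ, Continuous χ ∧ HasCompactSupport χ ∧ 0 ≤ χ ∧ χ x₀ ≠ 0 ∧
      ∀ k ∈ K, ∀ k' ∈ K, ∀ x, χ (k * x * k') = χ x := by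
  obtain ⟨f, hfc, hf0, hfx⟩ := exists_continuous_nonneg_pos x₀
  let F : G → G × G → ℝ := fun x p => f (p.1 * x * p.2)
  have hF : Continuous ↿F := by
    simp only [F, Function.HasUncurry.uncurry, id]
    fun_prop
  let χ : G → ℝ := fun x => sSup (F x '' ((K : Set G) ×ˢ (K : Set G)))
  have hbdd : ∀ x, BddAbove (F x '' ((K : Set G) ×ˢ (K : Set G))) := fun x =>
    ((hK.prod hK).image (by fun_prop : Continuous (F x))).bddAbove
  have hle : ∀ x, f x ≤ χ x := fun x =>
    le_csSup (hbdd x) ⟨(1, 1), ⟨K.one_mem, K.one_mem⟩, by simp [F]⟩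
  refine ⟨χ, (hK.prod hK).continuous_sSup hF, ?_, fun x => (hf0 x).trans (hle x), ?_, ?_⟩
  · refine HasCompactSupport.intro ((hK.mul hfc).mul hK) fun x hx => ?_
    have : F x '' ((K : Set G) ×ˢ (K : Set G)) = {0} := by
      refine Set.Subset.antisymm ?_ (Set.singleton_subset_iff.2 ?_)
      · rintro _ ⟨⟨k, k'⟩, ⟨hk, hk'⟩, rfl⟩
        by_contra hne
        refine hx ⟨x * k', ⟨k⁻¹, inv_mem hk, k * x * k', subset_tsupport _ hne, ?_⟩,
          k'⁻¹, inv_mem hk', by simp⟩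
        simp [mul_assoc]
      · refine ⟨(1, 1), ⟨K.one_mem, K.one_mem⟩, ?_⟩
        by_contra hne
        simp only [F, one_mul, mul_one] at hne
        exact hx ⟨x, ⟨1, K.one_mem, x, subset_tsupport _ hne, by simp⟩, 1, K.one_mem, by simp⟩
    simp only [χ, this, csSup_singleton]
  · exact (((hf0 x₀).lt_of_ne' hfx).trans_le (hle x₀)).ne'
  · intro k hk k' hk' x
    simp only [χ]
    congr 1
    ext r
    constructor
    · rintro ⟨⟨p, q⟩, ⟨hp, hq⟩, rfl⟩
      exact ⟨(p * k, k' * q), ⟨mul_mem hp hk, mul_mem hk' hq⟩, by simp [F, mul_assoc]⟩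
    · rintro ⟨⟨p, q⟩, ⟨hp, hq⟩, rfl⟩
      exact ⟨(p * k⁻¹, k'⁻¹ * q), ⟨mul_mem hp (inv_mem hk), mul_mem (inv_mem hk') hq⟩,
        by simp [F, mul_assoc]⟩

variable [MeasurableSpace G] [BorelSpace G] {μ : Measure G}

/-- A continuous bi-`K`-invariant function that integrates to zero against every bi-`K`-invariant
compactly supported continuous function vanishes. -/
theorem eq_zero_of_forall_integral_mul_eq_zero [LocallyCompactSpace G]
    [IsFiniteMeasureOnCompacts μ] [μ.IsOpenPosMeasure] {K : Subgroup G}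
    (hK : IsCompact (K : Set G)) {h : G → ℂ} (hh : Continuous h) (hinv : IsBiInvariant K h)
    (hint : ∀ g : G → ℂ, Continuous g → HasCompactSupport g → IsBiInvariant K g →
      ∫ x, g x * h x ∂μ = 0) (x₀ : G) : h x₀ = 0 := by
  by_contra hne
  obtain ⟨χ, hχ, hχc, hχ0, hχx, hχK⟩ := exists_isBiInvariant_bump hK x₀
  have hsupp : HasCompactSupport fun x => (χ x : ℂ) * (starRingEnd ℂ) (h x) :=
    HasCompactSupport.mul_right (f := fun x => (χ x : ℂ))
      (hχc.comp_left (g := fun r : ℝ => (r : ℂ)) Complex.ofReal_zero)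
  have h0 := hint (fun x => (χ x : ℂ) * (starRingEnd ℂ) (h x))
    ((Complex.continuous_ofReal.comp hχ).mul (Complex.continuous_conj.comp hh)) hsupp
    fun k hk k' hk' x => by
      simp only [hχK k hk k' hk', hinv k hk k' hk']
  have heq : (fun x => (χ x : ℂ) * (starRingEnd ℂ) (h x) * h x) =
      fun x => ((χ x * ‖h x‖ ^ 2 : ℝ) : ℂ) := by
    funext x
    rw [mul_assoc, mul_comm ((starRingEnd ℂ) (h x)), Complex.mul_conj']
    push_cast; rfl
  rw [heq, integral_complex_ofReal, Complex.ofReal_eq_zero] at h0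
  have hc : Continuous fun x => χ x * ‖h x‖ ^ 2 := hχ.mul (hh.norm.pow 2)
  have hpos : 0 < ∫ x, χ x * ‖h x‖ ^ 2 ∂μ :=
    hc.integral_pos_of_hasCompactSupport_nonneg_nonzero (x := x₀) hχc.mul_right
      (fun x => mul_nonneg (hχ0 x) (sq_nonneg _))
      (mul_ne_zero hχx (pow_ne_zero 2 (norm_ne_zero_iff.2 hne)))
  exact hpos.ne' h0

/-- Integrating `ψ` against a convolution `f * g`. -/
theorem integral_integral_mul_left_eq [μ.IsMulLeftInvariant] [IsFiniteMeasureOnCompacts μ]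
    {f g ψ : G → ℂ} (hf : Continuous f) (hfc : HasCompactSupport f) (hg : Continuous g)
    (hgc : HasCompactSupport g) (hψ : Continuous ψ) :
    ∫ x, f x * ∫ y, g y * ψ (x * y) ∂μ ∂μ = ∫ z, (∫ y, f y * g (y⁻¹ * z) ∂μ) * ψ z ∂μ := by
  have hswap := integral_integral_swap_of_hasCompactSupport (μ := μ) (ν := μ)
    (f := fun x z => f x * (g (x⁻¹ * z) * ψ z)) (by
      simp only [Function.uncurry_def]; fun_prop) (by
      refine HasCompactSupport.intro (hfc.prod (hfc.mul hgc)) ?_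
      rintro ⟨x, z⟩ hxz
      simp only [Function.uncurry]
      by_contra hne
      have h1 : x ∈ tsupport f := subset_tsupport _ (left_ne_zero_of_mul hne)
      have h2 : x⁻¹ * z ∈ tsupport g :=
        subset_tsupport _ (left_ne_zero_of_mul (right_ne_zero_of_mul hne))
      exact hxz ⟨h1, x, h1, x⁻¹ * z, h2, by simp⟩)
  calc ∫ x, f x * ∫ y, g y * ψ (x * y) ∂μ ∂μ
      = ∫ x, ∫ z, f x * (g (x⁻¹ * z) * ψ z) ∂μ ∂μ := by
        refine integral_congr_ae (.of_forall fun x => ?_)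
        simp only
        rw [← integral_const_mul,
          ← integral_mul_left_eq_self (fun z => f x * (g (x⁻¹ * z) * ψ z)) x]
        simp only [inv_mul_cancel_left]
    _ = _ := by
        rw [hswap]
        refine integral_congr_ae (.of_forall fun z => ?_)
        beta_reduce
        rw [← integral_mul_const]
        simp only [mul_assoc]

end BiInvariant

namespace UnitaryRep

variable {G : Type*} [Group G] [TopologicalSpace G] {H : Type*}
  [NormedAddCommGroup H] [InnerProductSpace ℂ H] [CompleteSpace H] {π : UnitaryRep G H}
  {K : Subgroup G}

/-- The vector `∫ g(y) π(y) b dy` is `K`-fixed when `g` is left `K`-invariant, so the projection onto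
the `K`-fixed vectors may be inserted. -/
theorem integral_mul_inner_op_fixedProj [IsTopologicalGroup G] [MeasurableSpace G] [BorelSpace G]
    {μ : Measure G} [μ.IsMulLeftInvariant] [IsFiniteMeasureOnCompacts μ] {g : G → ℂ}
    (hg : Continuous g) (hgc : HasCompactSupport g) (hgK : IsBiInvariant K g) (a b : H) (x : G) :
    ∫ y, g y * inner ℂ a (π.op x (π.fixedProj K (π.op y b))) ∂μ =
      ∫ y, g y * inner ℂ a (π.op (x * y) b) ∂μ := by
  have hint : Integrable (fun y => g y • π.op y b) μ :=
    (hg.smul (π.continuous_op b)).integrable_of_hasCompactSupport hgc.smul_right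
  let B : H := ∫ y, g y • π.op y b ∂μ
  have hB : B ∈ π.fixedVectors K := by
    intro k hk
    have h1 : π.op k B = ∫ y, g y • π.op (k * y) b ∂μ := by
      rw [← ContinuousLinearMap.integral_comp_comm _ hint]
      simp only [map_smul, op_mul]
    refine h1.trans (.trans ?_ (integral_mul_left_eq_self (fun y => g y • π.op y b) k))
    refine integral_congr_ae (.of_forall fun y => ?_)
    have := hgK k hk 1 K.one_mem y
    simp only [mul_one] at this
    simp only [this]
  have key : ∀ T : H →L[ℂ] H, ∫ y, g y * inner ℂ a (T (π.op y b)) ∂μ = inner ℂ a (T B) := by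
    intro T
    have := ((innerSL ℂ a).comp T).integral_comp_comm hint
    simpa using this
  have h1 := key (π.op x ∘L π.fixedProj K)
  have h2 := key (π.op x)
  simp only [ContinuousLinearMap.comp_apply, π.fixedProj_eq_self hB] at h1
  simp only [op_mul, h1, h2]

end UnitaryRep

/-- For a Gelfand pair `(G, K)` and a unitary representation `π` of `G`, the compressions
`P π(x) P` to the `K`-fixed vectors commute. Both sides are continuous bi-`K`-invariant functions
of `x` and of `y`, and by commutativity of the convolution they have the same integral against
`f(x) g(y)` for bi-`K`-invariant `f` and `g` in `C_c(G)`. -/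
theorem IsGelfandPair.inner_op_fixedProj_op_comm {G : Type*} [Group G] [TopologicalSpace G]
    {K : Subgroup G} (hGK : IsGelfandPair G K) {H : Type*} [NormedAddCommGroup H]
    [InnerProductSpace ℂ H] [CompleteSpace H] (π : UnitaryRep G H) {a b : H}
    (ha : a ∈ π.fixedVectors K) (hb : b ∈ π.fixedVectors K) (x y : G) :
    inner ℂ a (π.op x (π.fixedProj K (π.op y b))) =
      inner ℂ a (π.op y (π.fixedProj K (π.op x b))) := by
  have := hGK.toIsTopologicalGroup
  have := hGK.toLocallyCompactSpace
  let _ : MeasurableSpace G := borel G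
  have : BorelSpace G := ⟨rfl⟩
  let μ : Measure G := Measure.haar
  let F : G → G → ℂ := fun x y => inner ℂ a (π.op x (π.fixedProj K (π.op y b)))
  have hFeq : ∀ x y, F x y = inner ℂ (π.op x⁻¹ a) (π.fixedProj K (π.op y b)) := fun x y =>
    π.inner_op_right _ _ _
  have hF : Continuous fun p : G × G => F p.1 p.2 := by
    simp only [hFeq]
    exact ((π.continuous_op a).comp continuous_fst.inv).inner
      ((π.fixedProj K).continuous.comp ((π.continuous_op b).comp continuous_snd))
  have hFl : ∀ y, IsBiInvariant K fun x => F x y := fun y k hk k' hk' x => by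
    simp only [hFeq, mul_inv_rev, UnitaryRep.op_mul]
    rw [ha _ (inv_mem hk), UnitaryRep.inner_op_left, inv_inv, UnitaryRep.op_fixedProj _ hk']
  have hFr : ∀ x, IsBiInvariant K fun y => F x y := fun x k hk k' hk' y => by
    simp only [F, UnitaryRep.op_mul]
    rw [hb _ hk', UnitaryRep.fixedProj_op _ hk]
  have hcomm : ∀ f g : G → ℂ, Continuous f → HasCompactSupport f → IsBiInvariant K f →
      Continuous g → HasCompactSupport g → IsBiInvariant K g →
      ∫ x, f x * ∫ y, g y * F x y ∂μ ∂μ = ∫ x, f x * ∫ y, g y * F y x ∂μ ∂μ := by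
    intro f g hf hfc hfK hg hgc hgK
    have hψ : Continuous fun z => inner ℂ a (π.op z b) :=
      continuous_const.inner (π.continuous_op b)
    have hconv := hGK.convolution_comm f g (hf.integrable_of_hasCompactSupport hfc)
      (hg.integrable_of_hasCompactSupport hgc) hfK hgK
    calc ∫ x, f x * ∫ y, g y * F x y ∂μ ∂μ
        = ∫ z, (∫ y, f y * g (y⁻¹ * z) ∂μ) * inner ℂ a (π.op z b) ∂μ := by
          simp only [F, UnitaryRep.integral_mul_inner_op_fixedProj hg hgc hgK]
          exact integral_integral_mul_left_eq hf hfc hg hgc hψ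
      _ = ∫ z, (∫ y, g y * f (y⁻¹ * z) ∂μ) * inner ℂ a (π.op z b) ∂μ := by
          refine integral_congr_ae ?_
          filter_upwards [hconv] with z hz
          exact congrArg (· * inner ℂ a (π.op z b)) hz
      _ = ∫ y, g y * ∫ x, f x * F y x ∂μ ∂μ := by
          simp only [F, UnitaryRep.integral_mul_inner_op_fixedProj hf hfc hfK]
          exact (integral_integral_mul_left_eq hg hgc hf hfc hψ).symm
      _ = ∫ y, ∫ x, g y * (f x * F y x) ∂μ ∂μ := by simp only [integral_const_mul]
      _ = ∫ x, ∫ y, g y * (f x * F y x) ∂μ ∂μ := by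
          refine integral_integral_swap_of_hasCompactSupport ?_ ?_
          · simp only [Function.uncurry_def]; fun_prop
          · refine HasCompactSupport.intro (hgc.prod hfc) ?_
            rintro ⟨y, x⟩ hxy
            simp only [Function.uncurry]
            by_contra hne
            exact hxy ⟨subset_tsupport _ (left_ne_zero_of_mul hne),
              subset_tsupport _ (left_ne_zero_of_mul (right_ne_zero_of_mul hne))⟩
      _ = _ := by simp only [mul_left_comm (g _), integral_const_mul]
  let D : G → G → ℂ := fun x y => F x y - F y x
  have hD : Continuous fun p : G × G => D p.1 p.2 :=
    hF.sub (hF.comp continuous_swap)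
  have hDl : ∀ y, IsBiInvariant K fun x => D x y := fun y k hk k' hk' x => by
    simp only [D]
    rw [show F (k * x * k') y = F x y from hFl y k hk k' hk' x,
      show F y (k * x * k') = F y x from hFr y k hk k' hk' x]
  have hDr : ∀ x, IsBiInvariant K fun y => D x y := fun x k hk k' hk' y => by
    simp only [D]
    rw [show F (k * y * k') x = F y x from hFl x k hk k' hk' y,
      show F x (k * y * k') = F x y from hFr x k hk k' hk' y]
  have hsub : ∀ g : G → ℂ, Continuous g → HasCompactSupport g → ∀ x,
      ∫ y, g y * D x y ∂μ = ∫ y, g y * F x y ∂μ - ∫ y, g y * F y x ∂μ := by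
    intro g hg hgc x
    rw [← integral_sub]
    · simp only [D, mul_sub]
    · exact Continuous.integrable_of_hasCompactSupport (by fun_prop) hgc.mul_right
    · exact Continuous.integrable_of_hasCompactSupport (by fun_prop) hgc.mul_right
  have hcontint : ∀ (g : G → ℂ) (E : G → G → ℂ), Continuous g → HasCompactSupport g →
      Continuous (fun p : G × G => E p.1 p.2) → Continuous fun x => ∫ y, g y * E x y ∂μ := by
    intro g E hg hgc hE
    rw [← continuousOn_univ]
    refine continuousOn_integral_of_compact_support hgc ?_ fun p y _ hy => ?_
    · simp only [Function.uncurry_def]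
      fun_prop
    · rw [image_eq_zero_of_notMem_tsupport hy, zero_mul]
  have hg0 : ∀ g : G → ℂ, Continuous g → HasCompactSupport g → IsBiInvariant K g → ∀ x,
      ∫ y, g y * D x y ∂μ = 0 := by
    intro g hg hgc hgK
    refine eq_zero_of_forall_integral_mul_eq_zero (μ := μ) hGK.isCompact
      (hcontint g D hg hgc hD) ?_ fun f hf hfc hfK => ?_
    · intro k hk k' hk' x
      simp only [fun y => show D (k * x * k') y = D x y from hDl y k hk k' hk' x]
    · simp only [hsub g hg hgc, mul_sub]
      rw [integral_sub, hcomm f g hf hfc hfK hg hgc hgK, sub_self]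
      · exact (hf.mul (hcontint g F hg hgc hF)).integrable_of_hasCompactSupport hfc.mul_right
      · exact (hf.mul (hcontint g (fun x y => F y x) hg hgc
          (hF.comp continuous_swap))).integrable_of_hasCompactSupport hfc.mul_right
  exact sub_eq_zero.1 (eq_zero_of_forall_integral_mul_eq_zero (μ := μ) hGK.isCompact
    (hD.comp (Continuous.prodMk_right x)) (hDr x) (fun g hg hgc hgK => hg0 g hg hgc hgK x) y)

/-! ### Haar averages and invariant means -/

section HaarAverage

variable {K : Type*} [Group K] [TopologicalSpace K] [IsTopologicalGroup K] [CompactSpace K]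

theorem haarAverage_add {f g : K → ℂ} (hf : Continuous f) (hg : Continuous g) :
    haarAverage (fun k => f k + g k) = haarAverage f + haarAverage g := by
  let _ : MeasurableSpace K := borel K
  have : BorelSpace K := ⟨rfl⟩
  exact integral_add (hf.integrable_of_hasCompactSupport (.of_compactSpace f))
    (hg.integrable_of_hasCompactSupport (.of_compactSpace g))

theorem haarAverage_const_mul (c : ℂ) (f : K → ℂ) :
    haarAverage (fun k => c * f k) = c * haarAverage f :=
  integral_const_mul c f

theorem haarMeasure_top_univ [MeasurableSpace K] [BorelSpace K] :
    Measure.haarMeasure (⊤ : TopologicalSpace.PositiveCompacts K) Set.univ = 1 :=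
  Measure.haarMeasure_self

theorem norm_haarAverage_le {f : K → ℂ} {C : ℝ} (hf : ∀ k, ‖f k‖ ≤ C) : ‖haarAverage f‖ ≤ C := by
  let _ : MeasurableSpace K := borel K
  have : BorelSpace K := ⟨rfl⟩
  have h := norm_integral_le_of_norm_le_const
    (μ := Measure.haarMeasure (⊤ : TopologicalSpace.PositiveCompacts K)) (.of_forall hf)
  rwa [Measure.real, haarMeasure_top_univ, ENNReal.toReal_one, mul_one] at h

theorem haarAverage_const (c : ℂ) : haarAverage (fun _ : K => c) = c := by
  let _ : MeasurableSpace K := borel K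
  have : BorelSpace K := ⟨rfl⟩
  refine (integral_const c).trans ?_
  rw [Measure.real, haarMeasure_top_univ, ENNReal.toReal_one, one_smul]

theorem haarAverage_nonneg {f : K → ℂ} (hf : ∀ k, 0 ≤ f k) : 0 ≤ haarAverage f := by
  let _ : MeasurableSpace K := borel K
  have : BorelSpace K := ⟨rfl⟩
  have hre : f = fun k => ((f k).re : ℂ) := funext fun k => Complex.eq_re_of_ofReal_le (hf k)
  have h : haarAverage f = ((∫ k, (f k).re ∂(Measure.haarMeasure
      (⊤ : TopologicalSpace.PositiveCompacts K)) : ℝ) : ℂ) := by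
    conv_lhs => rw [hre]
    exact integral_complex_ofReal
  rw [h, Complex.zero_le_real]
  exact integral_nonneg fun k => (Complex.le_def.1 (hf k)).1

theorem haarAverage_mul_left (f : K → ℂ) (g : K) :
    haarAverage (fun k => f (g * k)) = haarAverage f := by
  let _ : MeasurableSpace K := borel K
  have : BorelSpace K := ⟨rfl⟩
  exact integral_mul_left_eq_self f g

end HaarAverage

section RUCb

variable {G : Type*} [Group G] [TopologicalSpace G]

theorem RUCb.continuous_apply_inv (f : RUCb G) : Continuous fun g => f.1 g⁻¹ := by
  have h : Continuous fun g => leftTranslate g f.1 := f.2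
  refine continuous_iff_continuousAt.2 fun g₀ => ?_
  rw [ContinuousAt, tendsto_iff_norm_sub_tendsto_zero]
  refine squeeze_zero (fun _ => norm_nonneg _) (fun g => ?_)
    (tendsto_iff_norm_sub_tendsto_zero.1 (h.tendsto g₀))
  have := lp.norm_apply_le_norm (by simp) (leftTranslate g f.1 - leftTranslate g₀ f.1) 1
  change ‖f.1 (g⁻¹ * 1) - f.1 (g₀⁻¹ * 1)‖ ≤ _ at this
  rwa [mul_one, mul_one] at this

theorem memℓp_const {G : Type*} (c : ℂ) : Memℓp (fun _ : G => c) ∞ :=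
  memℓp_infty ⟨‖c‖, by rintro _ ⟨_, rfl⟩; rfl⟩

/-- The constant function `1` in `RUC_b(G)`. -/
def RUCb.one (G : Type*) [Group G] [TopologicalSpace G] : RUCb G :=
  ⟨⟨fun _ => 1, memℓp_const 1⟩, by
    have : (fun g : G => leftTranslate g (⟨fun _ => 1, memℓp_const 1⟩ : lp (fun _ : G => ℂ) ∞)) =
        fun _ => ⟨fun _ => 1, memℓp_const 1⟩ := by
      funext g; ext h; rfl
    change Continuous _
    rw [this]
    exact continuous_const⟩

variable {H : Type*} [NormedAddCommGroup H] [InnerProductSpace ℂ H] [CompleteSpace H]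

/-- The matrix coefficient `k ↦ ⟪a, π(k) b⟫` as an element of `RUC_b(K)`. -/
def UnitaryRep.coeff (π : UnitaryRep G H) (K : Subgroup G) (a b : H) : RUCb K :=
  ⟨⟨fun k => inner ℂ a (π.op k b), memℓp_infty ⟨‖a‖ * ‖b‖, by
      rintro _ ⟨k, rfl⟩
      exact (norm_inner_le_norm _ _).trans_eq (by rw [π.norm_op])⟩⟩, by
    refine continuous_iff_continuousAt.2 fun k₀ => ?_
    rw [ContinuousAt, tendsto_iff_norm_sub_tendsto_zero]
    have hlim : Tendsto (fun k : K => ‖π.op k a - π.op k₀ a‖ * ‖b‖) (𝓝 k₀) (𝓝 0) := by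
      have := ((π.continuous_op a).comp continuous_subtype_val).tendsto k₀
      simpa using (tendsto_iff_norm_sub_tendsto_zero.1 this).mul_const ‖b‖
    refine squeeze_zero (fun _ => norm_nonneg _) (fun k => ?_) hlim
    refine lp.norm_le_of_forall_le (by positivity) fun h => ?_
    have : inner ℂ a (π.op ((k⁻¹ * h : K) : G) b) - inner ℂ a (π.op ((k₀⁻¹ * h : K) : G) b) =
        inner ℂ (π.op k a - π.op k₀ a) (π.op h b) := by
      rw [inner_sub_left, π.inner_op_left, π.inner_op_left]
      simp [UnitaryRep.op_mul]
    change ‖inner ℂ a (π.op ((k⁻¹ * h : K) : G) b) - inner ℂ a (π.op ((k₀⁻¹ * h : K) : G) b)‖ ≤ _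
    rw [this]
    exact (norm_inner_le_norm _ _).trans_eq (by rw [π.norm_op])⟩

theorem UnitaryRep.coeff_apply (π : UnitaryRep G H) (K : Subgroup G) (a b : H) (k : K) :
    (π.coeff K a b).1 k = inner ℂ a (π.op k b) := rfl

theorem RUCb.ext {f f' : RUCb G} (h : ∀ g, f.1 g = f'.1 g) : f = f' :=
  Subtype.ext (lp.ext (funext h))

/-- Every invariant mean of a matrix coefficient is the matrix coefficient of the projection onto
the fixed vectors. -/
theorem IsInvariantMean.apply_coeff {K : Subgroup G} {μ : RUCb K →L[ℂ] ℂ}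
    (hμ : IsInvariantMean μ) (π : UnitaryRep G H) (a b : H) :
    μ (π.coeff K a b) = inner ℂ a (π.fixedProj K b) := by
  refine π.eq_inner_fixedProj b (fun a => μ (π.coeff K a b)) (‖μ‖ * ‖b‖) (fun x y => ?_)
    (fun c x => ?_) (fun x => ?_) (fun k hk x => ?_) (fun x hx => ?_) a
  · rw [← map_add]
    exact congrArg μ (RUCb.ext fun k => inner_add_left _ _ _)
  · rw [← smul_eq_mul, ← map_smul]
    exact congrArg μ (RUCb.ext fun k => inner_smul_left _ _ _)
  · refine (μ.le_opNorm _).trans ?_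
    rw [mul_assoc, mul_comm ‖b‖]
    refine mul_le_mul_of_nonneg_left ?_ μ.opNorm_nonneg
    refine lp.norm_le_of_forall_le (by positivity) fun k => ?_
    exact (norm_inner_le_norm _ _).trans_eq (by rw [π.norm_op])
  · refine hμ.invariant ⟨k, hk⟩ _ _ (lp.ext (funext fun h => ?_))
    change inner ℂ (π.op k x) (π.op h b) = inner ℂ x (π.op ((⟨k, hk⟩⁻¹ * h : K) : G) b)
    rw [π.inner_op_left, ← π.op_mul]
    rfl
  · have : π.coeff K x b = (inner ℂ x b : ℂ) • RUCb.one K := RUCb.ext fun k => by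
      have h : inner ℂ x (π.op k b) = inner ℂ x b := by
        rw [π.inner_op_right, hx _ (inv_mem k.2)]
      exact h.trans (mul_one _).symm
    rw [this, map_smul, hμ.map_one _ fun _ => rfl, smul_eq_mul, mul_one]

end RUCb

namespace DirectLimitGelfandPair

variable {G : Type*} [Group G] [TopologicalSpace G] (D : DirectLimitGelfandPair G)

theorem average_inner_op {H : Type*} [NormedAddCommGroup H] [InnerProductSpace ℂ H]
    [CompleteSpace H] (π : UnitaryRep G H) (n : ℕ) (a b : H) :
    D.average n (fun k => inner ℂ a (π.op k b)) = inner ℂ a (π.fixedProj (D.cpt n) b) := by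
  have := D.isTopologicalGroup_cpt n
  have := D.compactSpace_cpt n
  have hc : ∀ x, Continuous fun k : D.cpt n => inner ℂ x (π.op k b) := fun x =>
    continuous_const.inner ((π.continuous_op b).comp continuous_subtype_val)
  refine π.eq_inner_fixedProj b (fun a => D.average n fun k => inner ℂ a (π.op k b)) ‖b‖
    (fun x y => ?_) (fun c x => ?_) (fun x => ?_) (fun k hk x => ?_) (fun x hx => ?_) a
  · simp only [average, inner_add_left]
    exact haarAverage_add (hc x) (hc y)
  · simp only [average, inner_smul_left]
    exact haarAverage_const_mul _ _
  · refine norm_haarAverage_le fun k => ?_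
    exact (norm_inner_le_norm _ _).trans_eq (by rw [π.norm_op, mul_comm])
  · refine Eq.trans ?_ (haarAverage_mul_left (fun h : D.cpt n => inner ℂ x (π.op h b)) ⟨k, hk⟩⁻¹)
    simp only [average]
    congr 1
    funext h
    rw [π.inner_op_left, ← π.op_mul]
    rfl
  · refine Eq.trans ?_ (haarAverage_const (K := D.cpt n) (inner ℂ x b))
    simp only [average]
    congr 1
    funext k
    rw [π.inner_op_right, hx _ (inv_mem k.2)]

theorem cpt_le_cptInfty (n : ℕ) : D.cpt n ≤ D.cptInfty := le_iSup D.cpt n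

theorem exists_mem_cpt {k : G} (hk : k ∈ D.cptInfty) : ∃ n, k ∈ D.cpt n :=
  (Subgroup.mem_iSup_of_directed D.cpt_mono.directed_le).1 hk

/-- The average over `K_n` of a function in `RUC_b(K_∞)`. -/
def averageRUCb (n : ℕ) (f : RUCb D.cptInfty) : ℂ :=
  haveI := D.isTopologicalGroup_cpt n
  haveI := D.compactSpace_cpt n
  haarAverage fun k : D.cpt n => f.1 (Subgroup.inclusion (D.cpt_le_cptInfty n) k)

theorem norm_averageRUCb_le (n : ℕ) (f : RUCb D.cptInfty) : ‖D.averageRUCb n f‖ ≤ ‖f‖ := by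
  have := D.isTopologicalGroup_cpt n
  have := D.compactSpace_cpt n
  exact norm_haarAverage_le fun k => lp.norm_apply_le_norm (by simp) f.1 _

theorem continuous_comp_inclusion (n : ℕ) (f : RUCb D.cptInfty) :
    Continuous fun k : D.cpt n => f.1 (Subgroup.inclusion (D.cpt_le_cptInfty n) k) := by
  have := D.isTopologicalGroup_cpt n
  have hi : Continuous (Subgroup.inclusion (D.cpt_le_cptInfty n)) :=
    continuous_inclusion (D.cpt_le_cptInfty n)
  have := (RUCb.continuous_apply_inv f).comp (hi.comp continuous_inv)
  refine this.congr fun k => ?_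
  simp

theorem averageRUCb_add (n : ℕ) (f g : RUCb D.cptInfty) :
    D.averageRUCb n (f + g) = D.averageRUCb n f + D.averageRUCb n g := by
  have := D.isTopologicalGroup_cpt n
  have := D.compactSpace_cpt n
  exact haarAverage_add (D.continuous_comp_inclusion n f) (D.continuous_comp_inclusion n g)

theorem averageRUCb_smul (n : ℕ) (c : ℂ) (f : RUCb D.cptInfty) :
    D.averageRUCb n (c • f) = c * D.averageRUCb n f := by
  have := D.isTopologicalGroup_cpt n
  have := D.compactSpace_cpt n
  exact haarAverage_const_mul _ _

theorem averageRUCb_leftTranslate {n : ℕ} {g : D.cptInfty} (hg : (g : G) ∈ D.cpt n)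
    {f f' : RUCb D.cptInfty} (h : f'.1 = leftTranslate g f.1) :
    D.averageRUCb n f' = D.averageRUCb n f := by
  have := D.isTopologicalGroup_cpt n
  have := D.compactSpace_cpt n
  refine Eq.trans ?_ (haarAverage_mul_left
    (fun k : D.cpt n => f.1 (Subgroup.inclusion (D.cpt_le_cptInfty n) k)) ⟨g, hg⟩⁻¹)
  simp only [averageRUCb, h]
  rfl

/-- `K_∞` is amenable: a limit of the Haar averages over the `K_n` along a nonprincipal ultrafilter
is an invariant mean on `RUC_b(K_∞)`. -/
theorem exists_isInvariantMean : ∃ μ : RUCb D.cptInfty →L[ℂ] ℂ, IsInvariantMean μ := by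
  let U : Ultrafilter ℕ := hyperfilter ℕ
  have hlim : ∀ f : RUCb D.cptInfty, ∃ z, Tendsto (fun n => D.averageRUCb n f) U (𝓝 z) := by
    intro f
    obtain ⟨z, -, hz⟩ := (isCompact_closedBall (0 : ℂ) ‖f‖).ultrafilter_le_nhds
      (U.map fun n => D.averageRUCb n f) (by
        rw [le_principal_iff]
        exact Filter.mem_map.2 (Filter.univ_mem' fun n => by
          simpa using D.norm_averageRUCb_le n f))
    exact ⟨z, hz⟩
  choose m hm using hlim
  let L : RUCb D.cptInfty →ₗ[ℂ] ℂ :=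
    { toFun := m
      map_add' f g := tendsto_nhds_unique (hm (f + g)) (by
        simpa only [averageRUCb_add] using (hm f).add (hm g))
      map_smul' c f := tendsto_nhds_unique (hm (c • f)) (by
        simpa only [averageRUCb_smul, RingHom.id_apply, smul_eq_mul] using (hm f).const_mul c) }
  let μ : RUCb D.cptInfty →L[ℂ] ℂ := L.mkContinuous 1 fun f => by
    rw [one_mul]
    exact le_of_tendsto' (hm f).norm fun n => D.norm_averageRUCb_le n f
  refine ⟨μ, ⟨⟨fun f hf => ?_, fun f hf => ?_⟩, fun g f f' h => ?_⟩⟩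
  · refine tendsto_nhds_unique (hm f) (tendsto_const_nhds.congr fun n => ?_)
    have := D.isTopologicalGroup_cpt n
    have := D.compactSpace_cpt n
    simp only [averageRUCb, hf, haarAverage_const]
  · refine ge_of_tendsto' (hm f) fun n => ?_
    have := D.isTopologicalGroup_cpt n
    have := D.compactSpace_cpt n
    exact haarAverage_nonneg fun k => hf _
  · obtain ⟨N, hN⟩ := D.exists_mem_cpt g.2
    refine tendsto_nhds_unique (hm f') ((hm f).congr' ?_)
    have : ∀ᶠ n in (U : Filter ℕ), N ≤ n :=
      (Nat.cofinite_eq_atTop ▸ hyperfilter_le_cofinite) (eventually_ge_atTop N)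
    filter_upwards [this] with n hn
    exact (D.averageRUCb_leftTranslate (D.cpt_mono hn hN) h).symm

/-! ### The direct limit -/

/-- Two-sided translations of `G_∞` are continuous, as they are so on each `G_n`. -/
theorem continuous_mul_mul (D : DirectLimitGelfandPair G) (a b : G) : Continuous fun g => a * g * b := by
  refine D.isCoherentWith.continuous_iff.2 ?_
  rintro _ ⟨n, rfl⟩
  obtain ⟨i, hi⟩ := D.exists_mem_grp a
  obtain ⟨j, hj⟩ := D.exists_mem_grp b
  let m := max n (max i j)
  have ha : a ∈ D.grp m := D.grp_mono (by simp [m]) hi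
  have hb : b ∈ D.grp m := D.grp_mono (by simp [m]) hj
  refine ContinuousOn.mono (s := D.grp m) ?_ (D.grp_mono (le_max_left _ _))
  have := (D.isGelfandPair m).toIsTopologicalGroup
  rw [continuousOn_iff_continuous_domRestrict]
  have : Continuous fun g : D.grp m => (⟨a, ha⟩ * g * ⟨b, hb⟩ : D.grp m) := by fun_prop
  exact continuous_subtype_val.comp this

variable {H : Type*} [NormedAddCommGroup H] [InnerProductSpace ℂ H] [CompleteSpace H]
  {π : UnitaryRep G H}

theorem inner_op_fixedProj_op_comm {a b : H} (ha : a ∈ π.fixedVectors D.cptInfty)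
    (hb : b ∈ π.fixedVectors D.cptInfty) (x y : G) :
    inner ℂ a (π.op x (π.fixedProj D.cptInfty (π.op y b))) =
      inner ℂ a (π.op y (π.fixedProj D.cptInfty (π.op x b))) := by
  have hlim : ∀ x y, Tendsto (fun n => inner ℂ a (π.op x (π.fixedProj (D.cpt n) (π.op y b)))) atTop
      (𝓝 (inner ℂ a (π.op x (π.fixedProj D.cptInfty (π.op y b))))) := fun x y =>
    tendsto_const_nhds.inner
      (((π.op x).continuous.tendsto _).comp (π.tendsto_fixedProj D.cpt_mono (π.op y b)))
  obtain ⟨i, hi⟩ := D.exists_mem_grp x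
  obtain ⟨j, hj⟩ := D.exists_mem_grp y
  refine tendsto_nhds_unique_of_eventuallyEq (hlim x y) (hlim y x) ?_
  filter_upwards [eventually_ge_atTop (max i j)] with n hn
  have hfix : (π.restrict (D.grp n)).fixedVectors ((D.cpt n).subgroupOf (D.grp n)) =
      π.fixedVectors (D.cpt n) := by
    ext v
    exact ⟨fun h k hk => h ⟨k, D.cpt_le_grp n hk⟩ hk, fun h k hk => h k hk⟩
  have hproj : ∀ v, (π.restrict (D.grp n)).fixedProj ((D.cpt n).subgroupOf (D.grp n)) v =
      π.fixedProj (D.cpt n) v := fun v => by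
    simp only [UnitaryRep.fixedProj, hfix]
  have := (D.isGelfandPair n).inner_op_fixedProj_op_comm (π.restrict (D.grp n)) (a := a) (b := b)
    (fun k hk => ha k (D.cpt_le_cptInfty n hk)) (fun k hk => hb k (D.cpt_le_cptInfty n hk))
    ⟨x, D.grp_mono ((le_max_left _ _).trans hn) hi⟩ ⟨y, D.grp_mono ((le_max_right _ _).trans hn) hj⟩
  simpa only [hproj, UnitaryRep.restrict_op] using this

end DirectLimitGelfandPair

theorem UnitaryRep.apply_mul_mul {G : Type*} [Group G] [TopologicalSpace G] {H : Type*}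
    [NormedAddCommGroup H] [InnerProductSpace ℂ H] [CompleteSpace H] {π : UnitaryRep G H} {v : H}
    {φ : G → ℂ} (hφ : ∀ g, φ g = inner ℂ v (π.op g v)) (x k y : G) :
    φ (x * k * y) = inner ℂ (π.op x⁻¹ v) (π.op k (π.op y v)) := by
  rw [hφ, π.op_mul, π.op_mul, π.inner_op_right]

/-- A continuous positive-definite function is a coefficient of an irreducible spherical
representation as soon as, in its cyclic representation, the coefficients of the projection onto
the fixed vectors factorize. -/
theorem IsPositiveDefiniteFun.exists_isSpherical {G : Type u} [Group G] [TopologicalSpace G]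
    (D : DirectLimitGelfandPair G) {φ : G → ℂ} (hφ : IsPositiveDefiniteFun φ) (hφ_one : φ 1 = 1)
    (hcont : Continuous φ)
    (h : ∀ (H : Type u) [NormedAddCommGroup H] [InnerProductSpace ℂ H] [CompleteSpace H]
      (π : UnitaryRep G H) (v : H), (∀ g, φ g = inner ℂ v (π.op g v)) → ∀ x y,
        inner ℂ (π.op x⁻¹ v) (π.fixedProj D.cptInfty (π.op y v)) = φ x * φ y) :
    ∃ (H : Type u) (_ : NormedAddCommGroup H) (_ : InnerProductSpace ℂ H) (_ : CompleteSpace H)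
      (π : UnitaryRep G H), π.IsSpherical D.cptInfty ∧
        ∃ v ∈ π.fixedVectors D.cptInfty, ‖v‖ = 1 ∧ ∀ g, φ g = inner ℂ v (π.op g v) := by
  obtain ⟨H, _, _, _, π, v, hv, hcyc⟩ :=
    hφ.exists_unitaryRep fun a b => hcont.comp (D.continuous_mul_mul a b)
  have hv1 : ‖v‖ = 1 := by
    have := hv 1
    rw [hφ_one, π.op_one, inner_self_eq_norm_sq_to_K] at this
    have h2 : ‖v‖ ^ 2 = 1 := by
      rw [← RCLike.ofReal_pow] at this
      exact RCLike.ofReal_inj.1 (this.symm.trans RCLike.ofReal_one.symm)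
    exact (pow_eq_one_iff_of_nonneg (norm_nonneg v) two_ne_zero).1 h2
  obtain ⟨hsph, hvK⟩ := UnitaryRep.isSpherical_of_isCyclicVector hcyc hv1
    (UnitaryRep.fixedProj_eq_of_isCyclicVector (K := D.cptInfty) hcyc fun x y => by
      have := h H π v hv x⁻¹ y
      rwa [inv_inv, hv, hv, π.inner_op_right, inv_inv] at this)
  exact ⟨H, _, _, _, π, hsph, v, hvK, hv1, hv⟩

end

theorem theorem8 {G : Type u} [Group G] [TopologicalSpace G] (D : DirectLimitGelfandPair G)
    (φ : G → ℂ) (hφ : IsPositiveDefiniteFun φ) (hφ_one : φ 1 = 1) :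
    List.TFAE [
      ∀ μ : RUCb D.cptInfty →L[ℂ] ℂ, IsInvariantMean μ → IsSphericalWrt μ φ,
      ∃ μ : RUCb D.cptInfty →L[ℂ] ℂ, IsInvariantMean μ ∧ IsSphericalWrt μ φ,
      ∃ (H : Type u) (_ : NormedAddCommGroup H) (_ : InnerProductSpace ℂ H) (_ : CompleteSpace H)
        (π : UnitaryRep G H), π.IsSpherical D.cptInfty ∧
          ∃ v ∈ π.fixedVectors D.cptInfty, ‖v‖ = 1 ∧ ∀ g, φ g = inner ℂ v (π.op g v),
      IsOlshanskiSpherical D φ] := by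
  -- the factorization of an irreducible spherical representation, from one-dimensionality of `H^K`
  have hfactor : ∀ (H : Type u) [NormedAddCommGroup H] [InnerProductSpace ℂ H] [CompleteSpace H]
      (π : UnitaryRep G H) (v : H), π.IsSpherical D.cptInfty → v ∈ π.fixedVectors D.cptInfty →
      ‖v‖ = 1 → (∀ g, φ g = inner ℂ v (π.op g v)) → ∀ x y,
        inner ℂ (π.op x⁻¹ v) (π.fixedProj D.cptInfty (π.op y v)) = φ x * φ y := by
    intro H _ _ _ π v hπ hvK hv1 hv x y
    rw [hπ.1.fixedProj_eq (fun a ha b hb => D.inner_op_fixedProj_op_comm ha hb) hvK hv1,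
      inner_smul_right, ← π.inner_op_right, ← hv, ← hv, mul_comm]
  have hcontinuous : ∀ (H : Type u) [NormedAddCommGroup H] [InnerProductSpace ℂ H]
      [CompleteSpace H] (π : UnitaryRep G H) (v : H), (∀ g, φ g = inner ℂ v (π.op g v)) →
      Continuous φ := by
    intro H _ _ _ π v hv
    rw [funext hv]
    exact continuous_const.inner (π.continuous_op v)
  tfae_have 1 → 2 := fun h => by
    obtain ⟨μ, hμ⟩ := D.exists_isInvariantMean
    exact ⟨μ, hμ, h μ hμ⟩
  tfae_have 2 → 3 := by
    rintro ⟨μ, hμ, hcont, hsph⟩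
    refine hφ.exists_isSpherical D hφ_one hcont fun H _ _ _ π v hv x y => ?_
    obtain ⟨F, hF, hμF⟩ := hsph x y
    rw [← hμF, ← hμ.apply_coeff]
    exact congrArg μ (RUCb.ext fun k => by
      rw [hF, UnitaryRep.apply_mul_mul hv, UnitaryRep.coeff_apply])
  tfae_have 3 → 1 := by
    rintro ⟨H, _, _, _, π, hπ, v, hvK, hv1, hv⟩ μ hμ
    refine ⟨hcontinuous H π v hv, fun x y =>
      ⟨π.coeff D.cptInfty (π.op x⁻¹ v) (π.op y v), fun k => ?_, ?_⟩⟩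
    · rw [UnitaryRep.apply_mul_mul hv, UnitaryRep.coeff_apply]
    · rw [hμ.apply_coeff, hfactor H π v hπ hvK hv1 hv]
  have haverage : ∀ (H : Type u) [NormedAddCommGroup H] [InnerProductSpace ℂ H] [CompleteSpace H]
      (π : UnitaryRep G H) (v : H), (∀ g, φ g = inner ℂ v (π.op g v)) → ∀ x y,
      Tendsto (fun n => D.average n fun k => φ (x * k * y)) atTop
        (𝓝 (inner ℂ (π.op x⁻¹ v) (π.fixedProj D.cptInfty (π.op y v)))) := by
    intro H _ _ _ π v hv x y
    simp only [UnitaryRep.apply_mul_mul hv, D.average_inner_op]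
    exact tendsto_const_nhds.inner (π.tendsto_fixedProj D.cpt_mono _)
  tfae_have 3 → 4 := by
    rintro ⟨H, _, _, _, π, hπ, v, hvK, hv1, hv⟩
    refine ⟨hcontinuous H π v hv, fun x y => ?_⟩
    rw [← hfactor H π v hπ hvK hv1 hv]
    exact haverage H π v hv x y
  tfae_have 4 → 3 := by
    rintro ⟨hcont, hlim⟩
    exact hφ.exists_isSpherical D hφ_one hcont fun H _ _ _ π v hv x y =>
      tendsto_nhds_unique (haverage H π v hv x y) (hlim x y)
  tfae_finish
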